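/- A \emph{large ideal domain} (LID) is an infinite countable (commutative) integral domain $R$ such that for every $x\in R\setminus\{0\}$ the ideal $xR$ has finite index in $(R,+)$. Let $\mathcal A_R$ be the semigroup, under composition, of all affine maps $x\mapsto ux+v$ of $R$ with $u\in R\setminus\{0\}$ and $v\in R$; write $A_v:x\mapsto x+v$ for $v\in R$, and $M_u:x\mapsto ux$ for $u\in R\setminus\{0\}$. A set $S\subset R$ is \emph{affinely syndetic} if there is a finite set $F\subset\mathcal A_R$ such that for every $x\in R$ there is $g\in F$ with $g(x)\in S$. A \emph{measure preserving action} of $\mathcal A_R$ on a probability space $(\Omega,\mu)$ is a family $(T_g)_{g\in\mathcal A_R}$ of measurable, measure preserving maps $T_g:\Omega\to\Omega$ with $T_{gh}=T_g\circ T_h$ for all $g,h\in\mathcal A_R$. Theorem. Let $R$ be an LID, let $t\in\mathbb N$ and, for each $i=1,\dots,t$, let $(\Omega_i,\mu_i)$ be a probability space, let $(T^{(i)}_g)_{g\in\mathcal A_R}$ be a measure preserving action of $\mathcal A_R$ on $(\Omega_i,\mu_i)$, and let $B_i\subset\Omega_i$ be a measurable set with $\mu_i(B_i)>0$. Let $\delta\in(0,1)$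 and put $$R(B_i,\delta)=\Big\{u\in R\setminus\{0\}:\ \mu_i\big((T^{(i)}_{M_u})^{-1}B_i\cap (T^{(i)}_{A_u})^{-1}B_i\big)>\delta\,\mu_i(B_i)^2\Big\}.$$ Then the intersection $R(B_1,\delta)\cap\dots\cap R(B_t,\delta)$ is affinely syndetic and, in particular, nonempty. -/

import Mathlib

open MeasureTheory

/-- A large ideal domain: an infinite countable integral domain in which every principal ideal
`xR` with `x ≠ 0` has finite index as an additive subgroup. -/
class LargeIdealDomain (R : Type*) [CommRing R] : Prop extends
    IsDomain R, Infinite R, Countable R where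
  finiteIndex_span : ∀ x : R, x ≠ 0 → (Ideal.span {x}).toAddSubgroup.FiniteIndex

/-- The affine semigroup of `R`: all maps `x ↦ u x + v` with `u ≠ 0`, under composition. -/
def affineSemigroup (R : Type*) [CommRing R] [IsDomain R] : Submonoid (Function.End R) where
  carrier := {f | ∃ u v : R, u ≠ 0 ∧ f = fun x => u * x + v}
  one_mem' := ⟨1, 0, one_ne_zero, by funext x; change x = 1 * x + 0; simp⟩
  mul_mem' := by
    rintro _ _ ⟨u, v, hu, rfl⟩ ⟨u', v', hu', rfl⟩
    refine ⟨u * u', u * v' + v, mul_ne_zero hu hu', ?_⟩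
    funext x
    change u * (u' * x + v') + v = u * u' * x + (u * v' + v)
    ring

/-- The translation `A_v : x ↦ x + v`. -/
def affineAdd {R : Type*} [CommRing R] [IsDomain R] (v : R) : affineSemigroup R :=
  ⟨fun x => x + v, 1, v, one_ne_zero, by funext x; simp⟩

/-- The dilation `M_u : x ↦ u x`, for `u ≠ 0`. -/
def affineMul {R : Type*} [CommRing R] [IsDomain R] (u : R) (hu : u ≠ 0) : affineSemigroup R :=
  ⟨fun x => u * x, u, 0, hu, by funext x; simp⟩

/-- `S ⊆ R` is affinely syndetic if finitely many preimages `g⁻¹ S` under affine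
transformations `g` cover `R`: there is a finite set `F` of affine transformations such that every
`x ∈ R` satisfies `g x ∈ S` for some `g ∈ F`. -/
def AffinelySyndetic {R : Type*} [CommRing R] [IsDomain R] (S : Set R) : Prop :=
  ∃ F : Finset (affineSemigroup R), ∀ x : R, ∃ g ∈ F, (g.1 : R → R) x ∈ S

/-- A measure preserving action `(T_g)` of a semigroup `G` by maps of a measure space: each `T_g`
is (measurable and) measure preserving, and `T_{gh} = T_g ∘ T_h`.  When `G` has an identity `e`,
`T_e = id` is not required. -/
structure IsMeasurePreservingAction {G : Type*} [Semigroup G] {Ω : Type*} [MeasurableSpace Ω]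
    (T : G → Ω → Ω) (μ : Measure Ω) : Prop where
  measurePreserving : ∀ g, MeasurePreserving (T g) μ μ
  map_mul : ∀ g h, T (g * h) = T g ∘ T h

/-- The set of return times
`R(B, δ) = {u ∈ R \ {0} : μ(T_{M_u}⁻¹ B ∩ T_{A_u}⁻¹ B) > δ μ(B)²}`. -/
def returnSet {R : Type*} [CommRing R] [IsDomain R] {Ω : Type*} [MeasurableSpace Ω]
    (T : affineSemigroup R → Ω → Ω) (μ : Measure Ω) (B : Set Ω) (δ : ℝ) : Set R :=
  {u | ∃ hu : u ≠ 0,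
    μ.real (T (affineMul u hu) ⁻¹' B ∩ T (affineAdd u) ⁻¹' B) > δ * μ.real B ^ 2}

open Filter Topology

open scoped InnerProductSpace

attribute [local instance] Ultrafilter.semigroup Ultrafilter.addSemigroup

/-! If the intersection `E` of the return sets is not affinely syndetic, compactness gives a closed
translation invariant set of ultrafilters containing every affine preimage of the complement of `E`.
A minimal invariant subset contains an additive idempotent `q`, and below the join of the nonzero
dilates of `q` lies a multiplicative idempotent `p` that still avoids `E` (`exists_isAffinePair`).
But each return set belongs to every such `p`, hence so does their finite intersection.

For the latter, let `M_u`, `A_u` denote the Koopman isometries, `f = 1_B`, and split `f = f₁ + f₂`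
with `f₁` recurrent and `f₂` weakly mixing under translations along `q`. Along `p`, `⟪M_u f, A_u
f₁⟫` has the same limit as `⟪M_u f₁, f₁⟫`, namely `‖w‖²` with `w` the weak limit of `M_u f₁`;
pairing `w` with constants bounds this below by `μ(B)²`. The rest, `⟪f, M_u* A_u f₂⟫`, tends to `0`
by van der Corput (`IsMixing.tendsto_mulAdj_add`). Finite index of ideals makes recurrence and
mixing independent of the dilate (`recurrent_of_recurrent`). -/

/-- An ultrafilter is idempotent for a binary operation. -/
def Ultrafilter.IsIdempotentFor {M : Type*} (p : Ultrafilter M) (op : M → M → M) : Prop :=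
  ∀ Q : M → Prop, (∀ᶠ u in p, Q u) → ∀ᶠ x in p, ∀ᶠ y in p, Q (op x y)

/-- Every member `A` of the ultrafilter has a syndetic difference set `A - A`. -/
def Ultrafilter.HasSyndeticDifferences {G : Type*} [AddCommGroup G] (q : Ultrafilter G) : Prop :=
  ∀ A ∈ q, ∃ F : Finset G, ∀ x, ∃ v ∈ F, ∃ a ∈ A, ∃ b ∈ A, v + x = a - b

/-! ### Idempotent ultrafilters -/

/-- A nonempty closed translation invariant set of ultrafilters contains a minimal one. -/
theorem exists_minimal_closed_invariant {G : Type*} [AddCommGroup G]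
    {Y : Set (Ultrafilter G)} (hne : Y.Nonempty) (hcl : IsClosed Y)
    (hinv : ∀ q ∈ Y, ∀ v : G, q.map (v + ·) ∈ Y) :
    ∃ Z ⊆ Y, Minimal (fun N : Set (Ultrafilter G) =>
      IsClosed N ∧ N.Nonempty ∧ ∀ q ∈ N, ∀ v : G, q.map (v + ·) ∈ N) Z := by
  refine zorn_superset_nonempty {N : Set (Ultrafilter G) |
      IsClosed N ∧ N.Nonempty ∧ ∀ q ∈ N, ∀ v : G, q.map (v + ·) ∈ N} ?_ Y ⟨hcl, hne, hinv⟩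
  intro c hcs hc hcne
  refine ⟨⋂₀ c, ⟨isClosed_sInter fun t ht => (hcs ht).1, ?_, fun q hq v => ?_⟩, fun s hs =>
    Set.sInter_subset_of_mem hs⟩
  · rw [Set.sInter_eq_iInter]
    have := hcne.coe_sort
    exact IsCompact.nonempty_iInter_of_directed_nonempty_isCompact_isClosed _
      (DirectedOn.directed_val (IsChain.directedOn hc.symm)) (fun i => (hcs i.prop).2.1)
      (fun i => (hcs i.prop).1.isCompact) (fun i => (hcs i.prop).1)
  · exact Set.mem_sInter.2 fun t ht => (hcs ht).2.2 q (Set.mem_sInter.1 hq t ht) v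

/-- A closed translation invariant set of ultrafilters is a left ideal. -/
theorem add_mem_of_closed_invariant {G : Type*} [AddCommGroup G]
    {Y : Set (Ultrafilter G)} (hcl : IsClosed Y)
    (hinv : ∀ q ∈ Y, ∀ v : G, q.map (v + ·) ∈ Y) (r : Ultrafilter G) {q : Ultrafilter G}
    (hq : q ∈ Y) : r + q ∈ Y := by
  have hc : Tendsto (fun v : G => (pure v : Ultrafilter G) + q) r (𝓝 (r + q)) :=
    ((Ultrafilter.continuous_add_left q).tendsto r).comp (Ultrafilter.tendsto_pure_self r)
  refine hcl.mem_of_tendsto hc (Eventually.of_forall fun v => ?_)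
  have : (pure v : Ultrafilter G) + q = q.map (v + ·) := by
    refine Ultrafilter.coe_inj.1 (Filter.ext fun s => Iff.rfl)
  rw [this]
  exact hinv q hq v

theorem exists_idempotent_hasSyndeticDifferences {G : Type*} [AddCommGroup G]
    {Y : Set (Ultrafilter G)} (hne : Y.Nonempty) (hcl : IsClosed Y)
    (hinv : ∀ q ∈ Y, ∀ v : G, q.map (v + ·) ∈ Y) :
    ∃ q ∈ Y, q.IsIdempotentFor (· + ·) ∧ q.HasSyndeticDifferences := by
  obtain ⟨Z, hZY, hZ⟩ := exists_minimal_closed_invariant hne hcl hinv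
  obtain ⟨Zcl, Zne, Zinv⟩ := hZ.prop
  obtain ⟨q, hqZ, hq⟩ := exists_idempotent_in_compact_add_subsemigroup
    Ultrafilter.continuous_add_left Z Zne Zcl.isCompact
    fun x _ y hy => add_mem_of_closed_invariant Zcl Zinv x hy
  refine ⟨q, hZY hqZ, fun Q hQ => ?_, fun A hA => ?_⟩
  · rw [← hq] at hQ
    exact hQ
  -- Otherwise the ultrafilters in `Z` all of whose translates miss `A` form a nonempty closed
  -- invariant set; by minimality it is all of `Z`, yet it omits `q`.
  · have hcover : Z ⊆ ⋃ v : G, {r : Ultrafilter G | (v + ·) ⁻¹' A ∈ r} := by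
      by_contra hcon
      obtain ⟨r, hrZ, hr⟩ := Set.not_subset.1 hcon
      simp only [Set.mem_iUnion, not_exists] at hr
      have hN : IsClosed (Z ∩ ⋂ v : G, {r : Ultrafilter G | (v + ·) ⁻¹' Aᶜ ∈ r}) :=
        Zcl.inter (isClosed_iInter fun v => ultrafilter_isClosed_basic _)
      have hle := hZ.le_of_le (y := Z ∩ ⋂ v : G, {r : Ultrafilter G | (v + ·) ⁻¹' Aᶜ ∈ r})
        ⟨hN, ⟨r, hrZ, Set.mem_iInter.2 fun v => Ultrafilter.compl_mem_iff_notMem.2 (hr v)⟩, by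
          rintro s ⟨hsZ, hs⟩ v
          refine ⟨Zinv s hsZ v, Set.mem_iInter.2 fun w => ?_⟩
          have h : (w + v + ·) ⁻¹' Aᶜ ∈ s := Set.mem_iInter.1 hs (w + v)
          simp_rw [add_assoc] at h
          exact h⟩ Set.inter_subset_left
      have h0 := Set.mem_iInter.1 (hle hqZ).2 0
      have h1 : Aᶜ ∈ q := by simpa using h0
      exact Ultrafilter.compl_mem_iff_notMem.1 h1 hA
    obtain ⟨F, hF⟩ := Zcl.isCompact.elim_finite_subcover _
      (fun v => ultrafilter_isOpen_basic _) hcover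
    refine ⟨F, fun x => ?_⟩
    have hx := hF (Zinv q hqZ x)
    simp only [Set.mem_iUnion] at hx
    obtain ⟨v, hv, hvx⟩ := hx
    have h2 : (fun y => v + (x + y)) ⁻¹' A ∈ q := hvx
    obtain ⟨b, hb1, hb2⟩ := Ultrafilter.nonempty_of_mem (Filter.inter_mem h2 hA)
    exact ⟨v, hv, _, hb1, b, hb2, by
      change v + x = v + (x + b) - b
      abel⟩

/-- A filter on a commutative semigroup with zero which avoids zero and is preserved by nonzero
dilations is coarser than some multiplicatively idempotent ultrafilter. -/
theorem exists_mul_idempotent_le {R : Type*} [CommRing R] {l : Filter R} [l.NeBot]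
    (h0 : ∀ᶠ x in l, x ≠ 0) (hl : ∀ c : R, c ≠ 0 → Tendsto (c * ·) l l) :
    ∃ p : Ultrafilter R, ↑p ≤ l ∧ p.IsIdempotentFor (· * ·) := by
  have hcl : IsClosed {p : Ultrafilter R | ↑p ≤ l} := by
    have : {p : Ultrafilter R | ↑p ≤ l} = ⋂ X ∈ l, {p : Ultrafilter R | X ∈ p} := by
      ext p
      simp only [Set.mem_iInter]
      exact Iff.rfl
    rw [this]
    exact isClosed_biInter fun X _ => ultrafilter_isClosed_basic X
  obtain ⟨p, hp, hpp⟩ := exists_idempotent_in_compact_subsemigroup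
    (Ultrafilter.continuous_mul_left (M := R)) {p : Ultrafilter R | ↑p ≤ l}
    ⟨Ultrafilter.of l, Ultrafilter.of_le l⟩ hcl.isCompact (by
      intro x hx y hy X hX
      have hx0 : ∀ᶠ c in (x : Filter R), c ≠ 0 := hx h0
      have : ∀ᶠ c in x, ∀ᶠ z in y, c * z ∈ X := hx0.mono fun c hc => hy (hl c hc hX)
      exact this)
  refine ⟨p, hp, fun Q hQ => ?_⟩
  rw [← hpp] at hQ
  exact hQ

/-! ### Affine pairs of ultrafilters on a large ideal domain -/

namespace LargeIdealDomain

variable {R : Type*} [CommRing R] [LargeIdealDomain R]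

/-- Finitely many translates of a nonzero principal ideal cover. -/
theorem exists_finset_dvd_add (c : R) (hc : c ≠ 0) :
    ∃ F : Finset R, ∀ x, ∃ e ∈ F, c ∣ x + e := by
  have := finiteIndex_span c hc
  have := AddSubgroup.finite_quotient_of_finiteIndex (H := (Ideal.span {c}).toAddSubgroup)
  have := Fintype.ofFinite (R ⧸ (Ideal.span {c}).toAddSubgroup)
  classical
  refine ⟨Finset.univ.image fun k : R ⧸ (Ideal.span {c}).toAddSubgroup => -k.out, fun x => ?_⟩
  refine ⟨-(QuotientAddGroup.mk x : R ⧸ (Ideal.span {c}).toAddSubgroup).out,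
    Finset.mem_image_of_mem _ (Finset.mem_univ _), ?_⟩
  have h := QuotientAddGroup.eq.1
    (QuotientAddGroup.out_eq' (QuotientAddGroup.mk x : R ⧸ (Ideal.span {c}).toAddSubgroup))
  rw [← Ideal.mem_span_singleton, add_comm]
  exact h

/-- By finite index `q` concentrates on one residue class mod `c`; idempotence puts `x`, `y` and `x
+ y` in it, so it is the zero class. -/
theorem eventually_dvd {q : Ultrafilter R} (hq : q.IsIdempotentFor (· + ·)) (c : R) (hc : c ≠ 0) :
    ∀ᶠ x in q, c ∣ x := by
  obtain ⟨F, hF⟩ := exists_finset_dvd_add c hc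
  have h : ∀ᶠ x in q, ∃ e ∈ (F : Set R), c ∣ x + e := Eventually.of_forall hF
  obtain ⟨e, -, he⟩ := (Ultrafilter.eventually_exists_mem_iff F.finite_toSet).1 h
  obtain ⟨x, hx, hxy⟩ := (he.and (hq _ he)).exists
  obtain ⟨y, hy, hxy⟩ := (he.and hxy).exists
  have hce : c ∣ e := by
    have := dvd_sub (dvd_add hx hy) hxy
    ring_nf at this
    exact this
  exact he.mono fun z hz => (dvd_add_left hce).1 hz

theorem infinite_of_mem {q : Ultrafilter R} (hq : q.HasSyndeticDifferences) {A : Set R}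
    (hA : A ∈ q) : A.Infinite := by
  intro hfin
  obtain ⟨F, hF⟩ := hq A hA
  have hfin' : ((fun z : R × R × R => z.1 - z.2.1 - z.2.2) '' (A ×ˢ A ×ˢ (F : Set R))).Finite :=
    (hfin.prod (hfin.prod F.finite_toSet)).image _
  refine Set.infinite_univ (α := R) (hfin'.subset fun x _ => ?_)
  obtain ⟨v, hv, a, ha, b, hb, h⟩ := hF x
  refine ⟨(a, b, v), ⟨ha, hb, hv⟩, ?_⟩
  change a - b - v = x
  rw [← h]
  ring

/-- A pair of ultrafilters: `q` is additively idempotent with syndetic differences, and `p` is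
multiplicatively idempotent and finer than all the dilates of `q`. -/
structure IsAffinePair (q p : Ultrafilter R) : Prop where
  add_idem : q.IsIdempotentFor (· + ·)
  syndetic : q.HasSyndeticDifferences
  mul_idem : p.IsIdempotentFor (· * ·)
  transfer : ∀ Q : R → Prop, (∀ c ≠ 0, ∀ᶠ x in q, Q (c * x)) → ∀ᶠ u in p, Q u

theorem exists_isAffinePair {E : Set R} (hE : ¬ AffinelySyndetic E) :
    ∃ q p : Ultrafilter R, IsAffinePair q p ∧ ∀ᶠ u in p, u ∉ E := by
  set Y : Set (Ultrafilter R) := ⋂ g : affineSemigroup R,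
    {q : Ultrafilter R | (g.1 : R → R) ⁻¹' Eᶜ ∈ q} with hY
  have hYcl : IsClosed Y := isClosed_iInter fun g => ultrafilter_isClosed_basic _
  have hYne : Y.Nonempty := by
    have := isCompact_univ.inter_iInter_nonempty
      (fun g : affineSemigroup R => {q : Ultrafilter R | (g.1 : R → R) ⁻¹' Eᶜ ∈ q})
      (fun g => ultrafilter_isClosed_basic _) (fun F => by
        simp only [AffinelySyndetic, not_exists, not_forall, not_and] at hE
        obtain ⟨x, hx⟩ := hE F
        refine ⟨pure x, Set.mem_univ _, Set.mem_iInter₂.2 fun g hg => ?_⟩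
        exact hx g hg)
    rwa [Set.univ_inter] at this
  have hYinv : ∀ q ∈ Y, ∀ v : R, q.map (v + ·) ∈ Y := by
    intro q hq v
    refine Set.mem_iInter.2 fun g => ?_
    have h : {x | (g.1 : R → R) (x + v) ∈ Eᶜ} ∈ q := Set.mem_iInter.1 hq (g * affineAdd v)
    simp_rw [add_comm _ v] at h
    exact h
  obtain ⟨q, hqY, hq1, hq2⟩ := exists_idempotent_hasSyndeticDifferences hYne hYcl hYinv
  -- Joining all nonzero dilates makes the filter stable under dilation, as multiplicative
  -- idempotence below it requires.
  let l : Filter R := ⨆ c : {c : R // c ≠ 0}, map (c.1 * ·) q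
  have hmem : ∀ X : Set R, X ∈ l ↔ ∀ c : R, c ≠ 0 → ∀ᶠ x in q, c * x ∈ X := by
    intro X
    simp only [l, mem_iSup, Subtype.forall]
    exact Iff.rfl
  have : l.NeBot := by
    refine NeBot.mono (f := map ((1 : R) * ·) (q : Filter R)) inferInstance ?_
    exact le_iSup (fun c : {c : R // c ≠ 0} => map (c.1 * ·) (q : Filter R)) ⟨1, one_ne_zero⟩
  have hq0 : ∀ᶠ x in (q : Filter R), x ≠ 0 := by
    rw [Ultrafilter.eventually_not]
    intro h
    exact infinite_of_mem hq2 h (Set.finite_singleton 0)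
  obtain ⟨p, hpl, hp⟩ := exists_mul_idempotent_le (l := l)
    ((hmem _).2 fun c hc => hq0.mono fun x hx => mul_ne_zero hc hx) (fun c hc X hX => by
      refine (hmem _).2 fun d hd => ?_
      refine ((hmem _).1 hX (c * d) (mul_ne_zero hc hd)).mono fun x hx => ?_
      simpa [mul_assoc] using hx)
  refine ⟨q, p, ⟨hq1, hq2, hp, fun Q hQ => hpl ((hmem {x | Q x}).2 hQ)⟩, ?_⟩
  refine hpl ((hmem Eᶜ).2 fun c hc => ?_)
  exact Set.mem_iInter.1 hqY (affineMul c hc)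

namespace IsAffinePair

variable {q p : Ultrafilter R}

theorem eventually_dvd_right (h : IsAffinePair q p) {c : R} (hc : c ≠ 0) : ∀ᶠ u in p, c ∣ u :=
  h.transfer _ fun d _ => (eventually_dvd h.add_idem c hc).mono fun _ hx => hx.mul_left d

theorem eventually_ne_zero (h : IsAffinePair q p) : ∀ᶠ u in (p : Filter R), u ≠ 0 := by
  refine h.transfer _ fun c hc => ?_
  rw [Ultrafilter.eventually_not]
  refine fun hA => infinite_of_mem h.syndetic hA ((Set.finite_singleton 0).subset fun x hx => ?_)
  exact (mul_eq_zero.1 hx).resolve_left hc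

theorem eventually_sq_ne_one (h : IsAffinePair q p) : ∀ᶠ u in (p : Filter R), 1 - u ^ 2 ≠ 0 := by
  refine h.transfer _ fun c hc => ?_
  rw [Ultrafilter.eventually_not]
  refine fun hA => infinite_of_mem h.syndetic hA ?_
  refine Set.Finite.subset (Set.Finite.preimage (mul_right_injective₀ hc).injOn
    (Set.toFinite {(1 : R), -1})) fun x hx => ?_
  have hx1 : 1 - (c * x) ^ 2 = 0 := hx
  have hx2 : (1 - c * x) * (1 + c * x) = 0 := by linear_combination hx1
  rcases mul_eq_zero.1 hx2 with h1 | h1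
  · exact Or.inl (sub_eq_zero.1 h1).symm
  · exact Or.inr (eq_neg_of_add_eq_zero_right h1)

end IsAffinePair

end LargeIdealDomain

/-! ### Weak limits along ultrafilters in Hilbert space -/

section Hilbert

variable {H : Type*} [NormedAddCommGroup H] [InnerProductSpace ℝ H]

/-- The inner product of a bounded weakly convergent family with a strongly convergent one. -/
theorem tendsto_inner_of_weak_of_strong {α : Type*} {l : Filter α} {x y : α → H} {a b : H} {C : ℝ}
    (hC : ∀ u, ‖x u‖ ≤ C) (hx : ∀ h, Tendsto (fun u => ⟪x u, h⟫_ℝ) l (𝓝 ⟪a, h⟫_ℝ))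
    (hy : Tendsto y l (𝓝 b)) : Tendsto (fun u => ⟪x u, y u⟫_ℝ) l (𝓝 ⟪a, b⟫_ℝ) := by
  have h1 : Tendsto (fun u => ⟪x u, y u - b⟫_ℝ) l (𝓝 0) := by
    have h2 : Tendsto (fun u => C * ‖y u - b‖) l (𝓝 0) := by
      have := (tendsto_iff_norm_sub_tendsto_zero.1 hy).const_mul C
      rwa [mul_zero] at this
    refine squeeze_zero_norm (fun u => ?_) h2
    exact (norm_inner_le_norm _ _).trans (mul_le_mul_of_nonneg_right (hC u) (norm_nonneg _))
  have h3 := h1.add (hx b)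
  rw [zero_add] at h3
  refine h3.congr fun u => ?_
  rw [← inner_add_right, sub_add_cancel]

variable [CompleteSpace H]

/-- Bounded families in a Hilbert space converge weakly along ultrafilters. -/
theorem exists_weak_limit {α : Type*} (p : Ultrafilter α) {z : α → H} {C : ℝ}
    (hC : ∀ u, ‖z u‖ ≤ C) : ∃ w : H, ∀ h, Tendsto (fun u => ⟪z u, h⟫_ℝ) p (𝓝 ⟪w, h⟫_ℝ) := by
  have hb : ∀ u h, |⟪z u, h⟫_ℝ| ≤ C * ‖h‖ := fun u h =>
    (abs_real_inner_le_norm _ _).trans (mul_le_mul_of_nonneg_right (hC u) (norm_nonneg h))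
  have hlim : ∀ h : H, ∃ c : ℝ, |c| ≤ C * ‖h‖ ∧ Tendsto (fun u => ⟪z u, h⟫_ℝ) p (𝓝 c) := by
    intro h
    obtain ⟨c, hc, hc'⟩ := (isCompact_Icc (a := -(C * ‖h‖)) (b := C * ‖h‖)).ultrafilter_le_nhds
      (p.map fun u => ⟪z u, h⟫_ℝ)
      (le_principal_iff.2 (Ultrafilter.mem_map.2 (Eventually.of_forall fun u => abs_le.1 (hb u h))))
    exact ⟨c, abs_le.2 hc, hc'⟩
  choose L hL1 hL2 using hlim
  let φ : H →ₗ[ℝ] ℝ :=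
    { toFun := L
      map_add' := fun g h => tendsto_nhds_unique (hL2 (g + h)) (by
        simpa only [inner_add_right] using (hL2 g).add (hL2 h))
      map_smul' := fun c h => tendsto_nhds_unique (hL2 (c • h)) (by
        simpa only [inner_smul_right, RingHom.id_apply, smul_eq_mul] using (hL2 h).const_mul c) }
  refine ⟨(InnerProductSpace.toDual ℝ H).symm (φ.mkContinuous C hL1), fun h => ?_⟩
  rw [InnerProductSpace.toDual_symm_apply]
  exact hL2 h

/-- Along an idempotent ultrafilter, a family of isometries converges weakly to the orthogonal
projection onto the recurrent vectors. -/
theorem exists_recurrent_weak_limit {M : Type*} {op : M → M → M} {p : Ultrafilter M}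
    (hp : p.IsIdempotentFor op) (ρ : M → H →ₗᵢ[ℝ] H)
    (hρ : ∀ᶠ x in p, ∀ᶠ y in p, ∀ g, ρ (op x y) g = ρ x (ρ y g)) (g : H) :
    ∃ w : H, (∀ h, Tendsto (fun u => ⟪ρ u g, h⟫_ℝ) p (𝓝 ⟪w, h⟫_ℝ)) ∧
      Tendsto (fun u => ρ u w) p (𝓝 w) ∧ ⟪w, g⟫_ℝ = ‖w‖ ^ 2 := by
  have hC : ∀ u, ‖ρ u g‖ ≤ ‖g‖ := fun u => ((ρ u).norm_map g).le
  obtain ⟨w, hw⟩ := exists_weak_limit p hC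
  -- By idempotence `⟪ρ x w, w⟫` is the limit over `y` of `⟪ρ (op x y) g, w⟫`. For isometries this
  -- weak return of `w` forces the strong one.
  have hweak : Tendsto (fun u => ⟪ρ u w, w⟫_ℝ) p (𝓝 ⟪w, w⟫_ℝ) := by
    refine Metric.nhds_basis_closedBall.tendsto_right_iff.2 fun ε hε => ?_
    have h1 : ∀ᶠ u in p, ⟪ρ u g, w⟫_ℝ ∈ Metric.closedBall ⟪w, w⟫_ℝ ε :=
      (hw w) (Metric.closedBall_mem_nhds _ hε)
    filter_upwards [hp _ h1, hρ] with x hx hx'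
    have h2 := hw ((ρ x).toContinuousLinearMap.adjoint w)
    simp only [ContinuousLinearMap.adjoint_inner_right] at h2
    refine Metric.isClosed_closedBall.mem_of_tendsto h2 ?_
    filter_upwards [hx, hx'] with y hy hy'
    rw [hy' g] at hy
    exact hy
  have hstrong : Tendsto (fun u => ρ u w) p (𝓝 w) := by
    rw [tendsto_iff_norm_sub_tendsto_zero]
    have h1 : Tendsto (fun u => ‖ρ u w - w‖ ^ 2) p (𝓝 0) := by
      have h2 := (hweak.const_mul 2).const_sub (2 * ‖w‖ ^ 2)
      rw [real_inner_self_eq_norm_sq, sub_self] at h2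
      refine h2.congr fun u => ?_
      rw [norm_sub_sq_real, (ρ u).norm_map]
      ring
    have h3 := h1.sqrt
    rw [Real.sqrt_zero] at h3
    exact h3.congr fun u => Real.sqrt_sq (norm_nonneg _)
  refine ⟨w, hw, hstrong, ?_⟩
  have h1 := tendsto_inner_of_weak_of_strong hC hw hstrong
  simp only [LinearIsometry.inner_map_map] at h1
  rw [real_inner_comm, ← real_inner_self_eq_norm_sq]
  exact tendsto_nhds_unique tendsto_const_nhds h1

/-- The van der Corput trick along a multiplicatively idempotent ultrafilter. -/
theorem van_der_corput {M : Type*} [CommSemigroup M] {p : Ultrafilter M}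
    (hp : p.IsIdempotentFor (· * ·)) {z : M → H} {C : ℝ} (hC : ∀ u, ‖z u‖ ≤ C)
    (hz : ∀ᶠ b in p, Tendsto (fun u => ⟪z (u * b), z u⟫_ℝ) p (𝓝 0)) (h : H) :
    Tendsto (fun u => ⟪z u, h⟫_ℝ) p (𝓝 0) := by
  obtain ⟨w, hw⟩ := exists_weak_limit p hC
  suffices hw0 : w = 0 by
    have := hw h
    rwa [hw0, inner_zero_left] at this
  by_contra hw0
  have hwpos : 0 < ‖w‖ := norm_pos_iff.2 hw0
  have hG : ∀ᶠ u in p, ‖w‖ ^ 2 / 2 ≤ ⟪z u, w⟫_ℝ := by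
    have h1 := hw w
    rw [real_inner_self_eq_norm_sq] at h1
    exact (h1.eventually_const_lt (half_lt_self (by positivity))).mono fun _ => le_of_lt
  -- `S` is a sum of `N` nearly orthogonal shifts of `z`: its norm is `O(√N)`, but its pairing with
  -- `w` grows linearly in `N`. The second clause allows one more shift; cross terms at most `1/2`
  -- account for the `+ 1`.
  have key : ∀ N : ℕ, ∃ S : M → H, Tendsto (fun u => ⟪S u, z u⟫_ℝ) p (𝓝 0) ∧
      (∀ᶠ x in p, Tendsto (fun u => ⟪S (u * x), z u⟫_ℝ) p (𝓝 0)) ∧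
      ∀ᶠ u in p, ‖S u‖ ^ 2 ≤ N * (C ^ 2 + 1) ∧ N * (‖w‖ ^ 2 / 2) ≤ ⟪S u, w⟫_ℝ := by
    intro N
    induction N with
    | zero => exact ⟨fun _ => 0, by simp, by simp, by simp⟩
    | succ N ih =>
      obtain ⟨S, hS1, hS2, hS3⟩ := ih
      have hsmall : ∀ᶠ u in p, ⟪S u, z u⟫_ℝ ≤ 1 / 2 :=
        (hS1.eventually_lt_const (by norm_num)).mono fun _ => le_of_lt
      obtain ⟨x, hx1, hx2, hx3, hx4, hx5⟩ := (hz.and (hS2.and ((hp _ hz).and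
        ((hp _ hS2).and (hp _ (hS3.and (hsmall.and hG))))))).exists
      refine ⟨fun u => z (u * x) + S (u * x), ?_, ?_, ?_⟩
      · simpa only [inner_add_left, add_zero] using hx1.add hx2
      · filter_upwards [hx3, hx4] with y hy3 hy4
        simpa only [inner_add_left, add_zero, mul_assoc, mul_comm y x] using hy3.add hy4
      · filter_upwards [hx5] with u hu
        rw [mul_comm x u] at hu
        obtain ⟨⟨hu1, hu2⟩, hu3, hu4⟩ := hu
        have hzC : ‖z (u * x)‖ ^ 2 ≤ C ^ 2 := pow_le_pow_left₀ (norm_nonneg _) (hC _) 2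
        rw [norm_add_sq_real, inner_add_left, real_inner_comm]
        push_cast
        constructor <;> linarith
  obtain ⟨N, hN⟩ := exists_nat_gt (4 * (C ^ 2 + 1) / ‖w‖ ^ 2)
  have hN0 : (0 : ℝ) < N := lt_of_le_of_lt (by positivity) hN
  rw [div_lt_iff₀ (by positivity)] at hN
  obtain ⟨S, -, -, hS⟩ := key N
  obtain ⟨u, hu1, hu2⟩ := hS.exists
  have h1 : N * (‖w‖ ^ 2 / 2) ≤ ‖S u‖ * ‖w‖ := hu2.trans (real_inner_le_norm _ _)
  have h2 : N * ‖w‖ / 2 ≤ ‖S u‖ := by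
    refine le_of_mul_le_mul_right ?_ hwpos
    linarith
  have h3 : (N * ‖w‖ / 2) ^ 2 ≤ N * (C ^ 2 + 1) := (pow_le_pow_left₀ (by positivity) h2 2).trans hu1
  have h4 : (N : ℝ) * (N * ‖w‖ ^ 2) ≤ N * (4 * (C ^ 2 + 1)) := by linarith
  linarith [le_of_mul_le_mul_left h4 hN0]

end Hilbert

/-! ### Isometric representations of the affine semigroup -/

/-- A right representation of the affine semigroup of `R` by isometries of a Hilbert space. -/
structure AffineRep (R H : Type*) [CommRing R] [NormedAddCommGroup H] [InnerProductSpace ℝ H] where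
  add : R → H →ₗᵢ[ℝ] H
  mul : R → H →ₗᵢ[ℝ] H
  add_zero_apply : ∀ g, add 0 g = g
  add_add_apply : ∀ v w g, add (v + w) g = add v (add w g)
  mul_mul_apply : ∀ u w, u ≠ 0 → w ≠ 0 → ∀ g, mul (u * w) g = mul u (mul w g)
  add_mul_apply : ∀ u v, u ≠ 0 → ∀ g, add v (mul u g) = mul u (add (u * v) g)

namespace AffineRep

variable {R H : Type*} [CommRing R] [NormedAddCommGroup H] [InnerProductSpace ℝ H]
  (U : AffineRep R H)

theorem inner_add_apply_left (v : R) (g h : H) : ⟪U.add v g, h⟫_ℝ = ⟪g, U.add (-v) h⟫_ℝ := by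
  rw [← (U.add (-v)).inner_map_map, ← U.add_add_apply, neg_add_cancel, U.add_zero_apply]

theorem norm_add_sub_add (v w : R) (g : H) :
    ‖U.add v g - U.add w g‖ = ‖U.add (v - w) g - g‖ := by
  rw [← (U.add w).norm_map (U.add (v - w) g - g), map_sub, ← U.add_add_apply, add_sub_cancel]

/-- Vectors that are mixing along all nonzero dilates of `q`. -/
def IsMixing (q : Ultrafilter R) (g : H) : Prop :=
  ∀ d ≠ 0, ∀ h, Tendsto (fun x => ⟪U.add (d * x) g, h⟫_ℝ) q (𝓝 0)

/-- Vectors that are recurrent along all dilates of `q`. -/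
def IsRecurrent (q : Ultrafilter R) (g : H) : Prop :=
  ∀ c, Tendsto (fun x => U.add (c * x) g) q (𝓝 g)

theorem IsRecurrent.tendsto {q p : Ultrafilter R}
    (h : LargeIdealDomain.IsAffinePair q p) {U : AffineRep R H} {g : H} (hg : U.IsRecurrent q g) :
    Tendsto (fun u => U.add u g) p (𝓝 g) := by
  refine tendsto_iff_eventually.2 fun Q hQ => ?_
  exact h.transfer (fun u => Q (U.add u g)) fun c _ => tendsto_iff_eventually.1 (hg c) hQ

section Complete

variable [CompleteSpace H] {q : Ultrafilter R}

theorem exists_recurrent_weak_limit_add (hq : q.IsIdempotentFor (· + ·)) (d : R) (g : H) :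
    ∃ w : H, (∀ h, Tendsto (fun x => ⟪U.add (d * x) g, h⟫_ℝ) q (𝓝 ⟪w, h⟫_ℝ)) ∧
      Tendsto (fun x => U.add (d * x) w) q (𝓝 w) ∧ ⟪w, g⟫_ℝ = ‖w‖ ^ 2 :=
  exists_recurrent_weak_limit hq (fun x => U.add (d * x))
    (Eventually.of_forall fun x => Eventually.of_forall fun y g => by
      rw [mul_add, U.add_add_apply]) g

/-- The adjoint of a dilation. -/
noncomputable def mulAdj (u : R) : H →L[ℝ] H := (U.mul u).toContinuousLinearMap.adjoint

theorem inner_mulAdj_left (u : R) (g h : H) : ⟪U.mulAdj u g, h⟫_ℝ = ⟪g, U.mul u h⟫_ℝ :=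
  ContinuousLinearMap.adjoint_inner_left _ _ _

theorem inner_mulAdj_right (u : R) (g h : H) : ⟪g, U.mulAdj u h⟫_ℝ = ⟪U.mul u g, h⟫_ℝ :=
  ContinuousLinearMap.adjoint_inner_right _ _ _

theorem mulAdj_mul (u : R) (g : H) : U.mulAdj u (U.mul u g) = g :=
  ext_inner_right ℝ fun h => by rw [inner_mulAdj_left, LinearIsometry.inner_map_map]

theorem mulAdj_add {u : R} (hu : u ≠ 0) (v : R) (g : H) :
    U.mulAdj u (U.add v g) = U.add (u * v) (U.mulAdj u g) :=
  ext_inner_right ℝ fun h => by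
    rw [inner_mulAdj_left, inner_add_apply_left, U.add_mul_apply u _ hu, inner_add_apply_left, inner_mulAdj_left,
      mul_neg]

theorem norm_mulAdj_le (u : R) (g : H) : ‖U.mulAdj u g‖ ≤ ‖g‖ := by
  have h1 : ‖U.mulAdj u g‖ * ‖U.mulAdj u g‖ ≤ ‖g‖ * ‖U.mulAdj u g‖ := by
    rw [← real_inner_self_eq_norm_mul_norm, inner_mulAdj_left]
    refine (real_inner_le_norm _ _).trans_eq ?_
    rw [LinearIsometry.norm_map]
  rcases (norm_nonneg (U.mulAdj u g)).eq_or_lt with h0 | h0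
  · rw [← h0]
    exact norm_nonneg g
  · exact le_of_mul_le_mul_right h1 h0

/-- The orthogonal projection onto the range of a dilation. -/
noncomputable def rangeProj (u : R) (g : H) : H := U.mul u (U.mulAdj u g)

theorem add_rangeProj {u : R} (hu : u ≠ 0) (v : R) (g : H) :
    U.add v (U.rangeProj u g) = U.rangeProj u (U.add v g) := by
  rw [rangeProj, rangeProj, U.add_mul_apply u v hu, U.mulAdj_add hu]

theorem inner_rangeProj (u : R) (g h : H) :
    ⟪U.rangeProj u g, h⟫_ℝ = ⟪g, U.rangeProj u h⟫_ℝ := by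
  rw [rangeProj, rangeProj, ← inner_mulAdj_right, inner_mulAdj_left]

theorem inner_rangeProj_self (u : R) (g : H) : ⟪g, U.rangeProj u g⟫_ℝ = ‖U.rangeProj u g‖ ^ 2 := by
  rw [rangeProj, ← inner_mulAdj_left, real_inner_self_eq_norm_sq, LinearIsometry.norm_map]

/-- Pythagoras: the range of `mul (c * d)` lies in that of `mul c`. -/
theorem norm_sq_rangeProj_sub {c d : R} (hc : c ≠ 0) (hd : d ≠ 0) (g : H) :
    ‖U.rangeProj c g - U.rangeProj (c * d) g‖ ^ 2
      = ‖U.rangeProj c g‖ ^ 2 - ‖U.rangeProj (c * d) g‖ ^ 2 := by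
  have h1 : ⟪U.rangeProj c g, U.rangeProj (c * d) g⟫_ℝ = ‖U.rangeProj (c * d) g‖ ^ 2 := by
    rw [← inner_rangeProj_self, inner_rangeProj]
    congr 1
    simp only [rangeProj, U.mul_mul_apply c d hc hd, mulAdj_mul]
  rw [norm_sub_sq_real, h1]
  ring

/-- Translating both vectors by `x` preserves the pairing, while `mul u g` goes weakly to `0` and
`k` returns strongly. -/
theorem IsMixing.inner_mul_eq_zero {U : AffineRep R H} {g k : H} (hg : U.IsMixing q g) (hk : U.IsRecurrent q k) {u : R}
    (hu : u ≠ 0) : ⟪U.mul u g, k⟫_ℝ = 0 := by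
  have h1 : ∀ h, Tendsto (fun x => ⟪U.add (1 * x) (U.mul u g), h⟫_ℝ) q (𝓝 ⟪(0 : H), h⟫_ℝ) := by
    intro h
    rw [inner_zero_left]
    refine (hg u hu (U.mulAdj u h)).congr fun x => ?_
    rw [U.add_mul_apply u _ hu, inner_mulAdj_right, one_mul]
  have h2 := tendsto_inner_of_weak_of_strong (fun x => ((U.add (1 * x)).norm_map _).le) h1 (hk 1)
  simp only [LinearIsometry.inner_map_map, inner_zero_left] at h2
  exact tendsto_nhds_unique tendsto_const_nhds h2

end Complete

variable [LargeIdealDomain R] {q p : Ultrafilter R}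

open LargeIdealDomain

/-- A vector recurrent along one dilate of `q` has a totally bounded orbit, hence is recurrent along
all of them. -/
theorem recurrent_of_recurrent (hq : q.IsIdempotentFor (· + ·)) (hs : q.HasSyndeticDifferences)
    {d : R} (hd : d ≠ 0) {g : H} (hg : Tendsto (fun x => U.add (d * x) g) q (𝓝 g)) :
    U.IsRecurrent q g := by
  intro c
  refine Metric.tendsto_nhds.2 fun ε hε => ?_
  simp only [dist_eq_norm]
  have hA : ∀ᶠ x in q, ‖U.add (d * x) g - g‖ < ε / 4 := by
    simpa only [dist_eq_norm] using Metric.tendsto_nhds.1 hg (ε / 4) (by positivity)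
  obtain ⟨F, hF⟩ := hs _ hA
  obtain ⟨E, hE⟩ := exists_finset_dvd_add d hd
  have hbdd : ∀ y : R, ∃ w ∈ Set.image2 (fun e v => e + d * v) (E : Set R) (F : Set R),
      ‖U.add (y + w) g - g‖ < ε / 2 := by
    intro y
    obtain ⟨e, he, x, hx⟩ := hE y
    obtain ⟨v, hv, a, ha, b, hb, hab⟩ := hF x
    refine ⟨e + d * v, Set.mem_image2_of_mem he hv, ?_⟩
    have h1 : y + (e + d * v) = d * a - d * b := by
      linear_combination hx + d * hab
    rw [h1, ← U.norm_add_sub_add]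
    have ha' : ‖U.add (d * a) g - g‖ < ε / 4 := ha
    have hb' : ‖U.add (d * b) g - g‖ < ε / 4 := hb
    calc ‖U.add (d * a) g - U.add (d * b) g‖
        = ‖(U.add (d * a) g - g) - (U.add (d * b) g - g)‖ := by rw [sub_sub_sub_cancel_right]
      _ ≤ ‖U.add (d * a) g - g‖ + ‖U.add (d * b) g - g‖ := norm_sub_le _ _
      _ < ε / 2 := by linarith
  -- One shift `w` works for `q`-most points; using it at both `y` and `x + y` cancels it and leaves
  -- a return at `c * x`.
  obtain ⟨w, -, hw⟩ := (Ultrafilter.eventually_exists_mem_iff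
    (E.finite_toSet.image2 _ F.finite_toSet)).1
    (Eventually.of_forall (f := (q : Filter R)) fun x => hbdd (c * x))
  filter_upwards [hq _ hw] with x hx
  obtain ⟨y, hy1, hy2⟩ := (hx.and hw).exists
  have h1 : U.add (c * (x + y) + w) g = U.add (c * x) (U.add (c * y + w) g) := by
    rw [← U.add_add_apply]
    congr 2
    ring
  rw [h1] at hy1
  calc ‖U.add (c * x) g - g‖
      = ‖(U.add (c * x) (U.add (c * y + w) g) - g)
          - U.add (c * x) (U.add (c * y + w) g - g)‖ := by
        rw [map_sub]
        congr 1
        abel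
    _ ≤ ‖U.add (c * x) (U.add (c * y + w) g) - g‖ + ‖U.add (c * y + w) g - g‖ := by
        refine (norm_sub_le _ _).trans_eq ?_
        rw [LinearIsometry.norm_map]
    _ < ε := by linarith

theorem IsMixing.tendsto (h : IsAffinePair q p) {U : AffineRep R H} {g : H} (hg : U.IsMixing q g) {d : R} (hd : d ≠ 0)
    (k : H) : Tendsto (fun u => ⟪U.add (d * u) g, k⟫_ℝ) p (𝓝 0) := by
  refine tendsto_iff_eventually.2 fun Q hQ => ?_
  refine h.transfer (fun u => Q ⟪U.add (d * u) g, k⟫_ℝ) fun c hc => ?_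
  simp only [← mul_assoc]
  exact tendsto_iff_eventually.1 (hg (d * c) (mul_ne_zero hd hc) k) hQ

variable [CompleteSpace H]

/-- Every vector splits into a part which is recurrent along all dilates of `q` and a part which is
mixing along all nonzero dilates of `q`. -/
theorem exists_recurrent_mixing_decomposition (hq : q.IsIdempotentFor (· + ·))
    (hs : q.HasSyndeticDifferences) (f : H) :
    ∃ f₁ f₂ : H, f = f₁ + f₂ ∧ U.IsRecurrent q f₁ ∧ U.IsMixing q f₂ := by
  obtain ⟨f₁, h1, h2, -⟩ := U.exists_recurrent_weak_limit_add hq 1 f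
  have hrec := U.recurrent_of_recurrent hq hs one_ne_zero h2
  have hmix : ∀ h, Tendsto (fun x => ⟪U.add (1 * x) (f - f₁), h⟫_ℝ) q (𝓝 ⟪(0 : H), h⟫_ℝ) := by
    intro h
    have h3 := (h1 h).sub (h2.inner (tendsto_const_nhds (x := h)))
    rw [sub_self] at h3
    simpa only [map_sub, inner_sub_left, inner_zero_left] using h3
  refine ⟨f₁, f - f₁, (add_sub_cancel _ _).symm, hrec, fun d hd h => ?_⟩
  -- A weak limit along `d` is recurrent along every dilate, hence orthogonal to `f - f₁`; but that
  -- pairing is `‖w‖²`.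
  obtain ⟨w, hw1, hw2, hw3⟩ := U.exists_recurrent_weak_limit_add hq d (f - f₁)
  have h4 := tendsto_inner_of_weak_of_strong (fun x => ((U.add (1 * x)).norm_map _).le) hmix
    (U.recurrent_of_recurrent hq hs hd hw2 1)
  simp only [LinearIsometry.inner_map_map, inner_zero_left] at h4
  have h5 := tendsto_nhds_unique tendsto_const_nhds h4
  rw [real_inner_comm, hw3, sq_eq_zero_iff, norm_eq_zero] at h5
  have := hw1 h
  rwa [h5, inner_zero_left] at this


/-- The projections onto the ranges of the dilations converge strongly along `p`. -/
theorem exists_eventually_rangeProj_close (h : IsAffinePair q p) (g : H) {ε : ℝ} (hε : 0 < ε) :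
    ∃ c ≠ 0, ∀ᶠ u in p, ‖U.rangeProj c g - U.rangeProj u g‖ < ε := by
  let s : Set ℝ := (fun c => ‖U.rangeProj c g‖ ^ 2) '' {c : R | c ≠ 0}
  have hs : BddBelow s := ⟨0, by
    rintro _ ⟨c, -, rfl⟩
    positivity⟩
  -- Projections shrink under divisibility and `p`-most `u` are multiples of `c`, so a
  -- near-minimizer `c` suffices.
  obtain ⟨_, ⟨c, hc, rfl⟩, hlt⟩ := exists_lt_of_csInf_lt (s := s) (b := sInf s + ε ^ 2)
    ⟨_, 1, one_ne_zero, rfl⟩ (lt_add_of_pos_right _ (by positivity))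
  refine ⟨c, hc, ?_⟩
  filter_upwards [h.eventually_dvd_right hc, h.eventually_ne_zero] with u hu hu0
  obtain ⟨d, rfl⟩ := hu
  refine lt_of_pow_lt_pow_left₀ 2 hε.le ?_
  rw [U.norm_sq_rangeProj_sub hc (right_ne_zero_of_mul hu0)]
  have := csInf_le hs ⟨c * d, hu0, rfl⟩
  simp only at this hlt
  linarith

variable {U}

/-- Replace `rangeProj u` by a fixed nearby `rangeProj c`, which is self-adjoint and commutes with
translations, so it moves onto `k`. -/
theorem IsMixing.tendsto_rangeProj (h : IsAffinePair q p) {g : H} (hg : U.IsMixing q g) {d : R}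
    (hd : d ≠ 0) (k : H) :
    Tendsto (fun u => ⟪k, U.add (d * u) (U.rangeProj u g)⟫_ℝ) p (𝓝 0) := by
  refine Metric.tendsto_nhds.2 fun ε hε => ?_
  simp only [dist_zero_right, Real.norm_eq_abs]
  have hk : 0 < 2 * (‖k‖ + 1) := by positivity
  obtain ⟨c, hc, hcu⟩ := U.exists_eventually_rangeProj_close h g (div_pos hε hk)
  have h1 : ∀ᶠ u in p, |⟪U.add (d * u) g, U.rangeProj c k⟫_ℝ| < ε / 2 := by
    simpa only [dist_zero_right, Real.norm_eq_abs] using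
      Metric.tendsto_nhds.1 (hg.tendsto h hd (U.rangeProj c k)) (ε / 2) (by positivity)
  filter_upwards [hcu, h1] with u hu1 hu2
  rw [← inner_rangeProj, ← U.add_rangeProj hc, real_inner_comm] at hu2
  have h2 : ⟪k, U.add (d * u) (U.rangeProj u g)⟫_ℝ = ⟪k, U.add (d * u) (U.rangeProj c g)⟫_ℝ
      - ⟪k, U.add (d * u) (U.rangeProj c g - U.rangeProj u g)⟫_ℝ := by
    rw [map_sub, inner_sub_right, sub_sub_cancel]
  have h3 : |⟪k, U.add (d * u) (U.rangeProj c g - U.rangeProj u g)⟫_ℝ| ≤ ε / 2 := by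
    refine (abs_real_inner_le_norm _ _).trans ?_
    rw [LinearIsometry.norm_map]
    rw [lt_div_iff₀ hk] at hu1
    nlinarith [norm_nonneg (U.rangeProj c g - U.rangeProj u g)]
  rw [h2]
  exact (abs_sub _ _).trans_lt (by linarith)

/-- The van der Corput correlation at `b` collapses to a translate of `rangeProj u g` by `(1 - b ^
2) * u`, which mixes as soon as `b ^ 2 ≠ 1`. -/
theorem IsMixing.tendsto_mulAdj_add (h : IsAffinePair q p) {g : H} (hg : U.IsMixing q g) (k : H) :
    Tendsto (fun u => ⟪U.mulAdj u (U.add u g), k⟫_ℝ) p (𝓝 0) := by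
  refine van_der_corput h.mul_idem (C := ‖g‖) (fun u => ?_) ?_ k
  · exact (U.norm_mulAdj_le _ _).trans_eq (LinearIsometry.norm_map _ _)
  · filter_upwards [h.eventually_ne_zero, h.eventually_sq_ne_one] with b hb hb2
    refine (hg.tendsto_rangeProj h hb2 (U.mulAdj b g)).congr' ?_
    filter_upwards [h.eventually_ne_zero] with u hu
    calc ⟪U.mulAdj b g, U.add ((1 - b ^ 2) * u) (U.rangeProj u g)⟫_ℝ
        = ⟪g, U.mul b (U.add ((1 - b ^ 2) * u) (U.rangeProj u g))⟫_ℝ := U.inner_mulAdj_left _ _ _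
      _ = ⟪g, U.add (-(u * b)) (U.mul b (U.add u (U.rangeProj u g)))⟫_ℝ := by
          rw [U.add_mul_apply b _ hb, ← U.add_add_apply]
          congr 4
          ring
      _ = ⟪U.add (u * b) g, U.mul b (U.mul u (U.mulAdj u (U.add u g)))⟫_ℝ := by
          rw [← inner_add_apply_left, U.add_rangeProj hu, rangeProj]
      _ = ⟪U.mulAdj (u * b) (U.add (u * b) g), U.mulAdj u (U.add u g)⟫_ℝ := by
          rw [← U.mul_mul_apply b u hb hu, mul_comm b u, inner_mulAdj_left]

/-- Dilations and translations return jointly, up to a small error, as often as if they were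
independent. -/
theorem eventually_lt_inner (U : AffineRep R H) (h : IsAffinePair q p) (f e : H) (he : ‖e‖ = 1)
    (headd : ∀ v, U.add v e = e) (hemul : ∀ u ≠ 0, U.mul u e = e) {r : ℝ} (hr : r < ⟪f, e⟫_ℝ ^ 2) :
    ∀ᶠ u in p, r < ⟪U.mul u f, U.add u f⟫_ℝ := by
  obtain ⟨f₁, f₂, hf, h1, h2⟩ := U.exists_recurrent_mixing_decomposition h.add_idem h.syndetic f
  have hfe : ⟪f₂, e⟫_ℝ = 0 := by
    refine tendsto_nhds_unique (tendsto_const_nhds.congr fun x => ?_) (h2 1 one_ne_zero e)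
    rw [← (U.add (1 * x)).inner_map_map, headd]
  obtain ⟨w, hw1, -, hw2⟩ := exists_recurrent_weak_limit h.mul_idem U.mul
    (h.eventually_ne_zero.mono fun x hx => h.eventually_ne_zero.mono fun y hy =>
      U.mul_mul_apply x y hx hy) f₁
  have hwe : ⟪w, e⟫_ℝ = ⟪f, e⟫_ℝ := by
    rw [hf, inner_add_left, hfe, add_zero]
    refine tendsto_nhds_unique (hw1 e) (tendsto_const_nhds.congr' ?_)
    filter_upwards [h.eventually_ne_zero] with u hu
    rw [← (U.mul u).inner_map_map, hemul u hu]
  have hbound : ⟪f, e⟫_ℝ ^ 2 ≤ ‖w‖ ^ 2 := by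
    rw [← hwe, ← sq_abs]
    refine pow_le_pow_left₀ (abs_nonneg _) ?_ 2
    simpa [he] using abs_real_inner_le_norm w e
  have hC : ∀ u, ‖U.mul u f‖ ≤ ‖f‖ := fun u => (LinearIsometry.norm_map _ _).le
  obtain ⟨w', hw'⟩ := exists_weak_limit p hC
  have hww' : ⟪w', f₁⟫_ℝ = ‖w‖ ^ 2 := by
    rw [← hw2]
    refine tendsto_nhds_unique (hw' f₁) ((hw1 f₁).congr' ?_)
    filter_upwards [h.eventually_ne_zero] with u hu
    rw [hf, map_add, inner_add_left, h2.inner_mul_eq_zero h1 hu, add_zero]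
  have h3 := (tendsto_inner_of_weak_of_strong hC hw' (h1.tendsto h)).add
    (h2.tendsto_mulAdj_add h f)
  rw [add_zero, hww'] at h3
  refine (h3.eventually_const_lt (hr.trans_le hbound)).mono fun u hu => ?_
  rwa [inner_mulAdj_left, real_inner_comm (U.mul u f), ← inner_add_right, ← map_add, ← hf] at hu

end AffineRep

/-! ### Koopman operators and return sets -/

section Koopman

variable {R : Type*} [CommRing R] [LargeIdealDomain R] {Ω : Type*} [MeasurableSpace Ω]
  {μ : Measure Ω} {T : affineSemigroup R → Ω → Ω}

/-- The Koopman operators on `L²`. -/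
noncomputable def koopman (hT : IsMeasurePreservingAction T μ) (g : affineSemigroup R) :
    Lp ℝ 2 μ →ₗᵢ[ℝ] Lp ℝ 2 μ :=
  Lp.compMeasurePreservingₗᵢ ℝ (T g) (hT.measurePreserving g)

theorem koopman_mul (hT : IsMeasurePreservingAction T μ) (g h : affineSemigroup R) (f : Lp ℝ 2 μ) :
    koopman hT (g * h) f = koopman hT h (koopman hT g f) := by
  refine Eq.trans ?_ (Lp.compMeasurePreserving_comp_apply f (hT.measurePreserving g)
    (hT.measurePreserving h))
  change Lp.compMeasurePreserving (T (g * h)) _ f = _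
  congr 2
  exact hT.map_mul g h

theorem affineAdd_mul_affineAdd (v w : R) :
    (affineAdd v * affineAdd w : affineSemigroup R) = affineAdd (w + v) :=
  Subtype.ext (funext fun x => add_assoc x w v)

theorem affineMul_mul_affineMul {u w : R} (hu : u ≠ 0) (hw : w ≠ 0) :
    affineMul u hu * affineMul w hw = affineMul (u * w) (mul_ne_zero hu hw) :=
  Subtype.ext (funext fun x => (mul_assoc u w x).symm)

theorem affineMul_mul_affineAdd {u : R} (hu : u ≠ 0) (v : R) :
    affineMul u hu * affineAdd v = affineAdd (u * v) * affineMul u hu :=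
  Subtype.ext (funext fun x => mul_add u x v)

open scoped Classical in
/-- The Koopman representation of the affine semigroup. -/
noncomputable def koopmanRep (hT : IsMeasurePreservingAction T μ) : AffineRep R (Lp ℝ 2 μ) where
  add v := koopman hT (affineAdd v)
  mul u := if hu : u ≠ 0 then koopman hT (affineMul u hu) else LinearIsometry.id
  add_zero_apply g := by
    -- The action of the identity need not be trivial, but its Koopman operator is an idempotent
    -- isometry, hence the identity.
    apply (koopman hT (affineAdd 0)).injective
    rw [← koopman_mul, affineAdd_mul_affineAdd, add_zero]
  add_add_apply v w g := by
    rw [← koopman_mul, affineAdd_mul_affineAdd]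
  mul_mul_apply u w hu hw g := by
    rw [dif_pos (mul_ne_zero hu hw), dif_pos hu, dif_pos hw, ← koopman_mul,
      affineMul_mul_affineMul hw hu]
    congr 2
    exact Subtype.ext (funext fun x => congrArg (· * x) (mul_comm u w))
  add_mul_apply u v hu g := by
    rw [dif_pos hu, ← koopman_mul, ← koopman_mul, affineMul_mul_affineAdd]

theorem koopmanRep_mul (hT : IsMeasurePreservingAction T μ) {u : R} (hu : u ≠ 0) :
    (koopmanRep hT).mul u = koopman hT (affineMul u hu) :=
  dif_pos hu

theorem koopman_indicatorConstLp [IsProbabilityMeasure μ] (hT : IsMeasurePreservingAction T μ)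
    (g : affineSemigroup R) {B : Set Ω} (hB : MeasurableSet B) :
    koopman hT g (indicatorConstLp 2 hB (measure_ne_top μ B) (1 : ℝ)) =
      indicatorConstLp 2 (hB.preimage (hT.measurePreserving g).measurable)
        (measure_ne_top μ _) (1 : ℝ) :=
  rfl

/-- The Hilbert space bound for `f = 1_B` and `e = 1`, where `⟪f, e⟫ = μ(B)`; `δ < 1` gives the
strict inequality. -/
theorem eventually_mem_returnSet [IsProbabilityMeasure μ] (hT : IsMeasurePreservingAction T μ)
    {B : Set Ω} (hB : MeasurableSet B) (hpos : 0 < μ B) {δ : ℝ} (hδ : δ < 1)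
    {q p : Ultrafilter R} (h : LargeIdealDomain.IsAffinePair q p) :
    ∀ᶠ u in p, u ∈ returnSet T μ B δ := by
  have hfe : ⟪indicatorConstLp 2 hB (measure_ne_top μ B) (1 : ℝ),
      indicatorConstLp 2 MeasurableSet.univ (measure_ne_top μ Set.univ) (1 : ℝ)⟫_ℝ = μ.real B := by
    rw [L2.real_inner_indicatorConstLp_one_indicatorConstLp_one, Set.inter_univ]
  have hB0 : 0 < μ.real B := ENNReal.toReal_pos hpos.ne' (measure_ne_top μ B)
  have key := (koopmanRep hT).eventually_lt_inner h
    (indicatorConstLp 2 hB (measure_ne_top μ B) (1 : ℝ))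
    (indicatorConstLp 2 MeasurableSet.univ (measure_ne_top μ Set.univ) (1 : ℝ))
    (by rw [norm_indicatorConstLp two_ne_zero ENNReal.ofNat_ne_top]; simp)
    (fun v => koopman_indicatorConstLp hT _ MeasurableSet.univ)
    (fun u hu => by
      rw [koopmanRep_mul hT hu]
      exact koopman_indicatorConstLp hT _ MeasurableSet.univ)
    (r := δ * μ.real B ^ 2) (by
      rw [hfe]
      exact mul_lt_of_lt_one_left (by positivity) hδ)
  filter_upwards [key, h.eventually_ne_zero] with u hu hu0
  refine ⟨hu0, ?_⟩
  rw [koopmanRep_mul hT hu0] at hu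
  change _ < ⟪_, koopman hT (affineAdd u) _⟫_ℝ at hu
  rwa [koopman_indicatorConstLp, koopman_indicatorConstLp,
    L2.real_inner_indicatorConstLp_one_indicatorConstLp_one] at hu

end Koopman

theorem mainTheorem3 {R : Type*} [CommRing R] [LargeIdealDomain R] (t : ℕ)
    (Ω : Fin t → Type*) [∀ i, MeasurableSpace (Ω i)]
    (μ : ∀ i, Measure (Ω i)) [∀ i, IsProbabilityMeasure (μ i)]
    (T : ∀ i, affineSemigroup R → Ω i → Ω i)
    (hT : ∀ i, IsMeasurePreservingAction (T i) (μ i))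
    (B : ∀ i, Set (Ω i)) (hB : ∀ i, MeasurableSet (B i)) (hpos : ∀ i, 0 < μ i (B i))
    (δ : ℝ) (hδ : δ ∈ Set.Ioo (0 : ℝ) 1) :
    AffinelySyndetic (⋂ i, returnSet (T i) (μ i) (B i) δ) ∧
      (⋂ i, returnSet (T i) (μ i) (B i) δ).Nonempty := by
  have hsynd : AffinelySyndetic (⋂ i, returnSet (T i) (μ i) (B i) δ) := by
    by_contra hE
    obtain ⟨q, p, h, hp⟩ := LargeIdealDomain.exists_isAffinePair hE
    have hmem : ∀ᶠ u in p, ∀ i, u ∈ returnSet (T i) (μ i) (B i) δ :=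
      eventually_all.2 fun i => eventually_mem_returnSet (hT i) (hB i) (hpos i) hδ.2 h
    obtain ⟨u, hu1, hu2⟩ := (hmem.and hp).exists
    exact hu2 (Set.mem_iInter.2 hu1)
  obtain ⟨F, hF⟩ := hsynd
  obtain ⟨g, -, hg⟩ := hF 0
  exact ⟨⟨F, hF⟩, _, hg⟩
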